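/- Let $\overline{\mathbb R}=(-\infty,\infty]$ and let $\mathbb R^n$ carry the Euclidean norm and inner product. For $s\in\mathbb R$, a function $\varphi:\mathbb R^n\to\overline{\mathbb R}$ is called $s$-convex if $$\varphi((1-\lambda)x+\lambda y)\le(1-\lambda)\varphi(x)+\lambda\varphi(y)-\tfrac{s}{2}\lambda(1-\lambda)\|x-y\|^2\quad\text{for all }x,y\in\mathbb R^n,\ \lambda\in(0,1);$$ it is convex if it is $0$-convex, and weakly convex if it is $s$-convex for some $s<0$. For $z\in\Omega\subset\mathbb R^m$ let $T_\Omega(z)$ be the set of all $w$ for which there are $t_k>0$, $t_k\to0$ and $w_k\to w$ with $z+t_kw_k\in\Omega$ for all $k$; let $\widehat N_\Omega(z)$ be the set of all $v$ with $\limsup_{z'\to z,\,z'\in\Omega\setminus\{z\}}\langle v,z'-z\rangle/\|z'-z\|\le0$; and let $N_\Omega(z)$ be the set of all limits of sequences $v_k\in\widehat N_\Omega(z_k)$ with $z_k\in\Omega$, $z_k\to z$. The limiting subdifferential of $\varphi$ is $$\partial\varphi(x)=\{v\in\mathbb R^n : (v,-1)\in N_{\operatorname{epi}\varphi}(x,\varphi(x))\}\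 \text{ if }\varphi(x)<\infty,\qquad \partial\varphi(x)=\emptyset\ \text{ otherwise},$$ where $\operatorname{epi}\varphi=\{(x,\alpha)\in\mathbb R^n\times\mathbb R:\alpha\ge\varphi(x)\}$. With $\operatorname{gph}\partial\varphi=\{(x,y):y\in\partial\varphi(x)\}$, the graphical derivative of $\partial\varphi$ at $(x,y)\in\operatorname{gph}\partial\varphi$ is $$D(\partial\varphi)(x,y)(w)=\{z\in\mathbb R^n:(w,z)\in T_{\operatorname{gph}\partial\varphi}(x,y)\},\quad w\in\mathbb R^n.$$ Theorem. Let $\varphi:\mathbb R^n\to\overline{\mathbb R}$ be lower semicontinuous and proper (that is, $\varphi\not\equiv\infty$). Then $\varphi$ is convex if and only if $\varphi$ is weakly convex and $$\langle z,w\rangle\ge0\quad\text{for all } z\in D(\partial\varphi)(x,y)(w),\ (x,y)\in\operatorname{gph}\partial\varphi,\ w\in\mathbb R^n.\tag{$*$}$$ Moreover, weak convexity cannot be dropped: the function $\varphi:\mathbb R\to\mathbb R$ with $\varphi(0)=0$ and $\varphi(x)=1$ for $x\ne0$ is proper and lower semicontinuous and satisfies $(*)$, but it is neither weakly convex nor convex.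 -/

import Mathlib

open Filter Topology

namespace VarAnalysis

/-- The contingent (Bouligand) tangent cone to `Ω` at `z`; it is empty when `z ∉ Ω`. -/
def contingentCone {Z : Type*} [NormedAddCommGroup Z] [NormedSpace ℝ Z]
    (Ω : Set Z) (z : Z) : Set Z :=
  {w | z ∈ Ω ∧ ∃ (t : ℕ → ℝ) (u : ℕ → Z), (∀ k, 0 < t k) ∧ Tendsto t atTop (𝓝 0) ∧
    Tendsto u atTop (𝓝 w) ∧ ∀ k, z + t k • u k ∈ Ω}

/-- The Fréchet (regular) normal cone to `Ω` at `z`; it is empty when `z ∉ Ω`.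
The last condition says that the upper limit of `⟪v, z' - z⟫ / ‖z' - z‖`, as `z' → z` with
`z' ∈ Ω`, is at most `0`. -/
def regularNormalCone {Z : Type*} [NormedAddCommGroup Z] [InnerProductSpace ℝ Z]
    (Ω : Set Z) (z : Z) : Set Z :=
  {v | z ∈ Ω ∧ ∀ ε : ℝ, 0 < ε → ∀ᶠ z' in 𝓝[Ω] z, inner ℝ v (z' - z) ≤ ε * ‖z' - z‖}

/-- The Mordukhovich (limiting) normal cone to `Ω` at `z`; it is empty when `z ∉ Ω`. -/
def limitingNormalCone {Z : Type*} [NormedAddCommGroup Z] [InnerProductSpace ℝ Z]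
    (Ω : Set Z) (z : Z) : Set Z :=
  {v | z ∈ Ω ∧ ∃ (ζ : ℕ → Z) (ν : ℕ → Z), (∀ k, ζ k ∈ Ω) ∧ Tendsto ζ atTop (𝓝 z) ∧
    Tendsto ν atTop (𝓝 v) ∧ ∀ k, ν k ∈ regularNormalCone Ω (ζ k)}

section Functions

variable {E : Type*} [NormedAddCommGroup E] [InnerProductSpace ℝ E]

/-- A proper function: never `-∞`, and finite somewhere. -/
def IsProper (φ : E → EReal) : Prop :=
  (∀ x, φ x ≠ ⊥) ∧ ∃ x, φ x < ⊤

/-- The epigraph, in `E × ℝ` with its Euclidean (`ℓ²`) structure. -/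
def epigraph (φ : E → EReal) : Set (WithLp 2 (E × ℝ)) :=
  {p | φ p.fst ≤ (p.snd : EReal)}

/-- The basic/limiting subdifferential, empty outside the effective domain. -/
def limitingSubdifferential (φ : E → EReal) (x : E) : Set E :=
  {v | φ x < ⊤ ∧ WithLp.toLp 2 (v, (-1 : ℝ)) ∈
    limitingNormalCone (epigraph φ) (WithLp.toLp 2 (x, (φ x).toReal))}

/-- `s`-convexity on the whole space, for functions that do not take the value `-∞`. -/
def IsSConvex (s : ℝ) (φ : E → EReal) : Prop :=
  ∀ x y : E, ∀ t : ℝ, 0 < t → t < 1 →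
    φ ((1 - t) • x + t • y) ≤
      ((1 - t : ℝ) : EReal) * φ x + (t : EReal) * φ y
        - ((s / 2 * t * (1 - t) * ‖x - y‖ ^ 2 : ℝ) : EReal)

/-- Convexity is `0`-convexity. -/
def IsConvex (φ : E → EReal) : Prop :=
  IsSConvex 0 φ

/-- Weak convexity is `s`-convexity for some `s < 0`. -/
def IsWeaklyConvex (φ : E → EReal) : Prop :=
  ∃ s : ℝ, s < 0 ∧ IsSConvex s φ

end Functions

/-- The graph of a set-valued mapping. -/
def gph {X Y : Type*} (F : X → Set Y) : Set (X × Y) :=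
  {p | p.2 ∈ F p.1}

/-- The graphical derivative `DF(x, y)(w)`; it is empty when `(x, y) ∉ gph F`. -/
def graphicalDerivative {X Y : Type*} [NormedAddCommGroup X] [NormedSpace ℝ X]
    [NormedAddCommGroup Y] [NormedSpace ℝ Y] (F : X → Set Y) (x : X) (y : Y) (w : X) : Set Y :=
  {z | (w, z) ∈ contingentCone (gph F) (x, y)}

/-- Positive semidefiniteness of the subgradient graphical derivative of `φ`. -/
def SubgradientGraphicalPSD {E : Type*} [NormedAddCommGroup E] [InnerProductSpace ℝ E]
    (φ : E → EReal) : Prop :=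
  ∀ x y : E, (x, y) ∈ gph (limitingSubdifferential φ) →
    ∀ w z : E, z ∈ graphicalDerivative (limitingSubdifferential φ) x y w → 0 ≤ inner ℝ z w

open Classical in
/-- The function with value `0` at the origin and `1` elsewhere. -/
noncomputable def offOrigin {E : Type*} [NormedAddCommGroup E] (x : E) : EReal :=
  if x = 0 then 0 else 1

end VarAnalysis

namespace VarAnalysis

/-! The hard direction passes through the Moreau envelope. If `φ` is `(-r)`-convex and `c > r / 2`,
then `φ + c‖x - ·‖²` is strongly convex, so it has a minimizer `P x` that is Lipschitz in `x`
(`IsSConvex.exists_isProx`, `IsProx.norm_sub_le`), and `(P x, 2c(x - P x))` lies in the subgradient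
graph. The envelope is differentiable along lines with gradient `2c(x - P x)`. Limits `w₀` of
difference quotients of `P` in a direction `u` give tangent pairs `(w₀, 2c(u - w₀))` to the graph,
so the sign condition forces `⟪2c(u - w₀), u⟫ ≥ 2c‖u - w₀‖² ≥ 0`
(`frequently_slope_neg_gradient_lt`). Hence the gradient is monotone on lines and every envelope is
convex. Letting `c → ∞`, the minimizers tend to the base point and lower semicontinuity passes
convexity to `φ`.

Conversely, convexity makes the subgradient graph monotone, and a limit of difference quotients
keeps the sign. In the counterexample the graph lies in the union of the two coordinate axes, where
tangent pairs are orthogonal. -/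

theorem coe_toReal_of_lt_top {X : Type*} {φ : X → EReal} (hφ : ∀ x, φ x ≠ ⊥) {x : X} (hx : φ x < ⊤) :
    (((φ x).toReal : ℝ) : EReal) = φ x :=
  EReal.coe_toReal hx.ne (hφ x)

theorem norm_fst_le_of_L2 {E F : Type*} [NormedAddCommGroup E]
    [NormedAddCommGroup F] (z : WithLp 2 (E × F)) :
    ‖z.fst‖ ≤ ‖z‖ := by
  have h := WithLp.prod_norm_sq_eq_of_L2 z
  nlinarith [norm_nonneg z, norm_nonneg z.fst, sq_nonneg ‖z.snd‖]

/-! ### Proximal points of weakly convex functions. -/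

section Prox

variable {E : Type*} [NormedAddCommGroup E] [InnerProductSpace ℝ E]

/-- `s`-convexity in terms of epigraph points: only real numbers are involved. -/
theorem IsSConvex.le_coe {s : ℝ} {φ : E → EReal} (h : IsSConvex s φ) {x y : E} {α β t : ℝ}
    (hx : φ x ≤ α) (hy : φ y ≤ β) (h0 : 0 < t) (h1 : t < 1) :
    φ ((1 - t) • x + t • y) ≤
      (((1 - t) * α + t * β - s / 2 * t * (1 - t) * ‖x - y‖ ^ 2 : ℝ) : EReal) := by
  refine (h x y t h0 h1).trans ?_
  push_cast [EReal.coe_sub, EReal.coe_add]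
  refine EReal.sub_le_sub (add_le_add ?_ ?_) le_rfl
  · exact mul_le_mul_of_nonneg_left hx (by exact_mod_cast (by linarith : (0 : ℝ) ≤ 1 - t))
  · exact mul_le_mul_of_nonneg_left hy (by exact_mod_cast h0.le)

theorem isSConvex_of_le_coe {s : ℝ} {φ : E → EReal} (hφ : ∀ x, φ x ≠ ⊥)
    (h : ∀ (x y : E) (α β t : ℝ), φ x ≤ α → φ y ≤ β → 0 < t → t < 1 →
      φ ((1 - t) • x + t • y) ≤
        (((1 - t) * α + t * β - s / 2 * t * (1 - t) * ‖x - y‖ ^ 2 : ℝ) : EReal)) :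
    IsSConvex s φ := by
  intro x y t h0 h1
  have h1' : 0 < 1 - t := by linarith
  have hbot : ∀ (u : ℝ) (z : E), 0 < u → (u : EReal) * φ z ≠ ⊥ := by
    intro u z hu
    rcases eq_or_ne (φ z) ⊤ with hz | hz
    · rw [hz, EReal.coe_mul_top_of_pos hu]; exact top_ne_bot
    · rw [← EReal.coe_toReal hz (hφ z), ← EReal.coe_mul]; exact EReal.coe_ne_bot _
  rcases eq_or_ne (φ x) ⊤ with hx | hx
  · rw [hx, EReal.coe_mul_top_of_pos h1', EReal.top_add_of_ne_bot (hbot t y h0),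
      EReal.top_sub_coe]
    exact le_top
  rcases eq_or_ne (φ y) ⊤ with hy | hy
  · rw [hy, EReal.coe_mul_top_of_pos h0, EReal.add_top_of_ne_bot (hbot _ x h1'),
      EReal.top_sub_coe]
    exact le_top
  have := h x y _ _ t (EReal.coe_toReal hx (hφ x)).ge (EReal.coe_toReal hy (hφ y)).ge h0 h1
  rw [← EReal.coe_toReal hx (hφ x), ← EReal.coe_toReal hy (hφ y)]
  exact_mod_cast this

/-- A lower semicontinuous weakly convex function is minorized by a quadratic. -/
theorem IsSConvex.exists_quadratic_minorant [FiniteDimensional ℝ E] {r : ℝ} {φ : E → EReal}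
    (hr : 0 ≤ r) (hφ : ∀ x, φ x ≠ ⊥) (hlsc : LowerSemicontinuous φ) (h : IsSConvex (-r) φ)
    {x₀ : E} (hx₀ : φ x₀ < ⊤) :
    ∃ A : ℝ, 0 ≤ A ∧ ∀ (y : E) (α : ℝ), φ y ≤ α →
      -A - A * ‖y - x₀‖ - r / 2 * ‖y - x₀‖ ^ 2 ≤ α := by
  have := FiniteDimensional.proper ℝ E
  obtain ⟨q, -, hq⟩ := LowerSemicontinuousOn.exists_isMinOn
    (s := Metric.closedBall x₀ 1) ⟨x₀, by simp⟩ (isCompact_closedBall x₀ 1)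
    (hlsc.lowerSemicontinuousOn _)
  have hqx : φ q ≤ φ x₀ := hq (by simp)
  set m := (φ q).toReal with hm
  have hmq : (m : EReal) = φ q := coe_toReal_of_lt_top hφ (hqx.trans_lt hx₀)
  set a := (φ x₀).toReal with ha
  have hax : (a : EReal) = φ x₀ := coe_toReal_of_lt_top hφ hx₀
  refine ⟨|m| + |a|, by positivity, fun y α hy => ?_⟩
  set d := ‖y - x₀‖ with hd
  have hd0 : 0 ≤ d := norm_nonneg _
  rcases le_or_gt d 1 with h1 | h1
  · have : φ q ≤ φ y := hq (by simpa [dist_eq_norm] using h1)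
    have : m ≤ α := by
      have := (hmq.le.trans this).trans hy
      exact_mod_cast this
    nlinarith [neg_abs_le m, abs_nonneg a, abs_nonneg m, mul_nonneg (abs_nonneg m) hd0,
      mul_nonneg (abs_nonneg a) hd0, mul_nonneg hr (sq_nonneg d)]
  · have hdpos : 0 < d := by linarith
    have hi : 1 / d < 1 := by rw [div_lt_one hdpos]; exact h1
    -- Outside the unit ball, compare with the point of the segment at distance `1` from `x₀`, where
    -- `φ ≥ m`.
    have key := h.le_coe hax.ge hy (by positivity : 0 < 1 / d) hi
    have hmem : φ q ≤ φ ((1 - 1 / d) • x₀ + (1 / d) • y) := by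
      apply hq
      have : (1 - 1 / d) • x₀ + (1 / d) • y - x₀ = (1 / d) • (y - x₀) := by module
      rw [Metric.mem_closedBall, dist_eq_norm, this, norm_smul, ← hd, Real.norm_eq_abs,
        abs_of_pos (by positivity)]
      field_simp
      rfl
    have h2 := (hmq.le.trans hmem).trans key
    rw [EReal.coe_le_coe_iff, norm_sub_rev, ← hd] at h2
    have h3 : d * m ≤ (d - 1) * a + α + r / 2 * (d - 1) * d := by
      have := mul_le_mul_of_nonneg_left h2 hdpos.le
      refine this.trans (le_of_eq ?_)
      field_simp
      ring
    nlinarith [neg_abs_le m, le_abs_self a, abs_nonneg a, abs_nonneg m, mul_nonneg hr hd0,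
      mul_le_mul_of_nonneg_left (neg_abs_le m) hd0,
      mul_le_mul_of_nonneg_left (le_abs_self a) (sub_nonneg.2 h1.le)]

/-- `p` is a minimizer of `φ + c ‖x - ·‖²`, at which `φ` is finite. -/
def IsProx (φ : E → EReal) (c : ℝ) (x p : E) : Prop :=
  φ p < ⊤ ∧ ∀ (y : E) (α : ℝ), φ y ≤ α →
    (φ p).toReal + c * ‖x - p‖ ^ 2 ≤ α + c * ‖x - y‖ ^ 2

theorem IsSConvex.exists_isProx [FiniteDimensional ℝ E] {r c : ℝ} {φ : E → EReal}
    (hr : 0 ≤ r) (hc : r / 2 < c) (hφ : IsProper φ) (hlsc : LowerSemicontinuous φ)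
    (h : IsSConvex (-r) φ) (x : E) : ∃ p, IsProx φ c x p := by
  have := FiniteDimensional.proper ℝ E
  obtain ⟨hbot, x₀, hx₀⟩ := hφ
  obtain ⟨A, hA, hmin⟩ := h.exists_quadratic_minorant hr hbot hlsc hx₀
  set D := ‖x - x₀‖ with hD
  have hD0 : 0 ≤ D := norm_nonneg _
  -- Recentring the minorant from `x₀` to `x`: `B` dominates both the constant and the linear
  -- coefficient after expanding `(‖x - y‖ + D)²`.
  set B := A + A * D + r / 2 * D ^ 2 + r * D with hB
  have hB0 : 0 ≤ B := by positivity
  have hminx : ∀ (y : E) (α : ℝ), φ y ≤ α →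
      -B - B * ‖x - y‖ - r / 2 * ‖x - y‖ ^ 2 ≤ α := by
    intro y α hy
    refine le_trans ?_ (hmin y α hy)
    have h1 : ‖y - x₀‖ ≤ ‖x - y‖ + D := by
      rw [norm_sub_rev x y, hD]; exact norm_sub_le_norm_sub_add_norm_sub _ _ _
    have h2 : ‖y - x₀‖ ^ 2 ≤ (‖x - y‖ + D) ^ 2 := pow_le_pow_left₀ (norm_nonneg _) h1 2
    have h3 := mul_le_mul_of_nonneg_left h1 hA
    have h4 := mul_le_mul_of_nonneg_left h2 (by linarith : 0 ≤ r / 2)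
    have h5 : 0 ≤ ‖x - y‖ := norm_nonneg _
    have h6 : 0 ≤ (A * D + r / 2 * D ^ 2) * ‖x - y‖ := by positivity
    have h7 : 0 ≤ r * D := by positivity
    rw [hB]
    nlinarith
  set a := (φ x₀).toReal with ha
  have hax : (a : EReal) = φ x₀ := coe_toReal_of_lt_top hbot hx₀
  set M := a + c * ‖x - x₀‖ ^ 2 with hM
  set κ := c - r / 2 with hκ
  have hκ0 : 0 < κ := by rw [hκ]; linarith
  -- On the sublevel set `κ‖x - y‖² ≤ M + B + B‖x - y‖`; this fails beyond `R`, where also `‖x - y‖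
  -- > 1`.
  set R := 1 + (|M| + 2 * B) / κ with hR
  have hR1 : 1 ≤ R := by
    have : 0 ≤ (|M| + 2 * B) / κ := by positivity
    linarith
  let F : E × ℝ → ℝ := fun z => z.2 + c * ‖x - z.1‖ ^ 2
  have hF : Continuous F := by fun_prop
  -- Minimizing over epigraph points makes the objective real and continuous; lower semicontinuity
  -- enters only as closedness of the epigraph.
  let K : Set (E × ℝ) := {z | φ z.1 ≤ (z.2 : EReal)} ∩ {z | F z ≤ M}
  have hKclosed : IsClosed K := by
    refine IsClosed.inter ?_ (isClosed_le hF continuous_const)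
    have hcont : Continuous fun z : E × ℝ => (z.1, (z.2 : EReal)) :=
      continuous_fst.prodMk (continuous_coe_real_ereal.comp continuous_snd)
    exact hlsc.isClosed_epigraph.preimage hcont
  have hKsub : K ⊆ Metric.closedBall x R ×ˢ Set.Icc (-B - B * R - r / 2 * R ^ 2) M := by
    rintro ⟨y, α⟩ ⟨h1, h2⟩
    have h1' := hminx y α h1
    have h2' : α + c * ‖x - y‖ ^ 2 ≤ M := h2
    have hy0 : 0 ≤ ‖x - y‖ := norm_nonneg _
    have hyR : ‖x - y‖ ≤ R := by
      by_contra! hlt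
      have h3 : (|M| + 2 * B) < κ * ‖x - y‖ := by
        have : (|M| + 2 * B) / κ < ‖x - y‖ := by linarith
        rwa [div_lt_iff₀' hκ0] at this
      have h4 : 1 < ‖x - y‖ := by linarith
      have h5 := mul_lt_mul_of_pos_right h3 (by linarith : 0 < ‖x - y‖)
      have h6 : κ * ‖x - y‖ ^ 2 ≤ M + B + B * ‖x - y‖ := by rw [hκ]; linarith
      nlinarith [le_abs_self M, abs_nonneg M]
    refine ⟨by simpa [dist_eq_norm, norm_sub_rev] using hyR, ?_, ?_⟩
    · have h3 := mul_le_mul_of_nonneg_left hyR hB0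
      have h4 := mul_le_mul_of_nonneg_left (pow_le_pow_left₀ hy0 hyR 2)
        (by linarith : 0 ≤ r / 2)
      linarith
    · have : 0 ≤ c * ‖x - y‖ ^ 2 := mul_nonneg (by linarith) (sq_nonneg _)
      change α ≤ M
      linarith
  have hKc : IsCompact K :=
    ((isCompact_closedBall x R).prod isCompact_Icc).of_isClosed_subset hKclosed hKsub
  obtain ⟨⟨p, β⟩, hpK, hp⟩ := hKc.exists_isMinOn ⟨(x₀, a), hax.ge, le_refl M⟩ hF.continuousOn
  have hpβ : φ p ≤ (β : EReal) := hpK.1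
  have hpM : β + c * ‖x - p‖ ^ 2 ≤ M := hpK.2
  have hptop : φ p < ⊤ := hpβ.trans_lt (EReal.coe_lt_top β)
  refine ⟨p, hptop, fun y α hy => ?_⟩
  have hle : (φ p).toReal ≤ β := by
    rw [← EReal.coe_le_coe_iff, coe_toReal_of_lt_top hbot hptop]; exact hpβ
  by_cases hyM : α + c * ‖x - y‖ ^ 2 ≤ M
  · have : β + c * ‖x - p‖ ^ 2 ≤ α + c * ‖x - y‖ ^ 2 :=
      hp (show (y, α) ∈ K from ⟨hy, hyM⟩)
    linarith
  · linarith

theorem norm_sub_midpoint_sq (x p q : E) :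
    ‖x - ((1 - 1 / 2 : ℝ) • p + (1 / 2 : ℝ) • q)‖ ^ 2 =
      1 / 2 * ‖x - p‖ ^ 2 + 1 / 2 * ‖x - q‖ ^ 2 - 1 / 4 * ‖p - q‖ ^ 2 := by
  have h1 : x - ((1 - 1 / 2 : ℝ) • p + (1 / 2 : ℝ) • q) =
      (1 / 2 : ℝ) • ((x - p) + (x - q)) := by module
  have h2 : p - q = (x - q) - (x - p) := by abel
  rw [h1, h2, norm_smul, mul_pow, norm_add_sq_real, norm_sub_sq_real (x - q) (x - p),
    real_inner_comm (x - p) (x - q)]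
  norm_num
  ring

/-- Testing minimality at the midpoint of `p` and `y`: the quadratic gains `c / 4`, weak convexity
loses `r / 8`, and doubling gives the constant. -/
theorem IsProx.quadratic_growth {r c : ℝ} {φ : E → EReal} (hbot : ∀ x, φ x ≠ ⊥)
    (h : IsSConvex (-r) φ) {x p y : E} (hp : IsProx φ c x p) (hy : φ y < ⊤) :
    (φ p).toReal + c * ‖x - p‖ ^ 2 + (c - r / 2) / 2 * ‖p - y‖ ^ 2 ≤
      (φ y).toReal + c * ‖x - y‖ ^ 2 := by
  have h1 := h.le_coe (coe_toReal_of_lt_top hbot hp.1).ge (coe_toReal_of_lt_top hbot hy).ge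
    (by norm_num : (0 : ℝ) < 1 / 2) (by norm_num)
  have h2 := hp.2 _ _ h1
  rw [norm_sub_midpoint_sq] at h2
  linarith

/-- Adding the growth estimates at `p` and `q` cancels the values of `φ`; the remaining squares
collapse to one inner product, bounded by Cauchy–Schwarz. -/
theorem IsProx.norm_sub_le {r c : ℝ} {φ : E → EReal} (hbot : ∀ x, φ x ≠ ⊥) (hr : 0 ≤ r)
    (hc : r / 2 < c) (h : IsSConvex (-r) φ) {x x' p q : E} (hp : IsProx φ c x p)
    (hq : IsProx φ c x' q) : ‖p - q‖ ≤ 2 * c / (c - r / 2) * ‖x - x'‖ := by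
  have h1 := hp.quadratic_growth hbot h hq.1
  have h2 := hq.quadratic_growth hbot h hp.1
  rw [norm_sub_rev q p] at h2
  have hκ : 0 < c - r / 2 := by linarith
  have h3 : ‖x - q‖ ^ 2 - ‖x - p‖ ^ 2 + ‖x' - p‖ ^ 2 - ‖x' - q‖ ^ 2 =
      2 * inner ℝ (x - x') (p - q) := by
    simp only [norm_sub_sq_real, inner_sub_left, inner_sub_right]
    ring
  have h4 : (c - r / 2) * ‖p - q‖ ^ 2 ≤ 2 * c * (‖x - x'‖ * ‖p - q‖) := by
    have h5 := real_inner_le_norm (x - x') (p - q)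
    have h6 := mul_le_mul_of_nonneg_left h5 (by linarith : 0 ≤ 2 * c)
    have h7 := congrArg (c * ·) h3
    linarith
  rcases (norm_nonneg (p - q)).eq_or_lt with h0 | h0
  · rw [← h0]
    exact mul_nonneg (div_nonneg (by linarith) hκ.le) (norm_nonneg _)
  · rw [div_mul_eq_mul_div, le_div_iff₀ hκ]
    refine le_of_mul_le_mul_right ?_ h0
    linarith

theorem inner_toLp_prod (v a : E) (s b : ℝ) :
    inner ℝ (WithLp.toLp 2 (v, s)) (WithLp.toLp 2 (a, b)) = inner ℝ v a + s * b := by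
  simp [WithLp.prod_inner_apply, mul_comm]

/-- A proximal subgradient is a limiting subgradient. -/
theorem mem_limitingSubdifferential_of_proximal {φ : E → EReal} (hbot : ∀ x, φ x ≠ ⊥)
    {c : ℝ} {p v : E} (hp : φ p < ⊤)
    (h : ∀ (y : E) (α : ℝ), φ y ≤ α →
      (φ p).toReal + inner ℝ v (y - p) - c * ‖y - p‖ ^ 2 ≤ α) :
    v ∈ limitingSubdifferential φ p := by
  have hmem : WithLp.toLp 2 (p, (φ p).toReal) ∈ epigraph φ :=
    (coe_toReal_of_lt_top hbot hp).ge
  refine ⟨hp, hmem, fun _ => _, fun _ => _, fun _ => hmem, tendsto_const_nhds,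
    tendsto_const_nhds, fun _ => ⟨hmem, fun ε hε => ?_⟩⟩
  have hball : ∀ᶠ z' in 𝓝[epigraph φ] (WithLp.toLp 2 (p, (φ p).toReal)),
      ‖z' - WithLp.toLp 2 (p, (φ p).toReal)‖ < ε / (|c| + 1) := by
    refine eventually_nhdsWithin_of_eventually_nhds ?_
    filter_upwards [Metric.ball_mem_nhds _ (by positivity : 0 < ε / (|c| + 1))] with z' hz'
    simpa [dist_eq_norm] using hz'
  filter_upwards [hball, self_mem_nhdsWithin] with z' h1 h2
  have h3 := h z'.fst z'.snd h2
  set d := z' - WithLp.toLp 2 (p, (φ p).toReal) with hd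
  have hd1 : d.fst = z'.fst - p := by simp [hd]
  have hd2 : d.snd = z'.snd - (φ p).toReal := by simp [hd]
  have h4 : inner ℝ (WithLp.toLp 2 (v, (-1 : ℝ))) d =
      inner ℝ v (z'.fst - p) - (z'.snd - (φ p).toReal) := by
    rw [← hd1, ← hd2]
    simp [WithLp.prod_inner_apply, sub_eq_add_neg]
  have h5 : ‖z'.fst - p‖ ≤ ‖d‖ := hd1 ▸ norm_fst_le_of_L2 d
  have h6 : (|c| + 1) * ‖d‖ ≤ ε := by
    rw [lt_div_iff₀' (by positivity)] at h1
    exact h1.le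
  have h7 : c * ‖z'.fst - p‖ ^ 2 ≤ (|c| + 1) * ‖d‖ * ‖d‖ := by
    have : ‖z'.fst - p‖ ^ 2 ≤ ‖d‖ ^ 2 := pow_le_pow_left₀ (norm_nonneg _) h5 2
    nlinarith [le_abs_self c, abs_nonneg c, sq_nonneg ‖z'.fst - p‖, sq_nonneg ‖d‖]
  have h8 := mul_le_mul_of_nonneg_right h6 (norm_nonneg d)
  rw [h4]
  linarith

theorem IsProx.mem_gph {φ : E → EReal} (hbot : ∀ x, φ x ≠ ⊥) {c : ℝ} {x p : E}
    (hp : IsProx φ c x p) : (p, (2 * c) • (x - p)) ∈ gph (limitingSubdifferential φ) := by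
  refine mem_limitingSubdifferential_of_proximal (c := c) hbot hp.1 fun y α hy => ?_
  have h := hp.2 y α hy
  have h1 : x - y = (x - p) - (y - p) := by abel
  rw [h1, norm_sub_sq_real (x - p)] at h
  change (φ p).toReal + inner ℝ ((2 * c) • (x - p)) (y - p) - c * ‖y - p‖ ^ 2 ≤ α
  rw [real_inner_smul_left]
  linarith

end Prox

/-! ### Convexity of the Moreau envelopes and passage to the limit. -/

section Envelope

variable {E : Type*} [NormedAddCommGroup E] [InnerProductSpace ℝ E]

/-- The Moreau envelope along a selection `P` of minimizers. -/
noncomputable def envelope (φ : E → EReal) (c : ℝ) (P : E → E) (x : E) : ℝ :=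
  (φ (P x)).toReal + c * ‖x - P x‖ ^ 2

variable {φ : E → EReal} {c : ℝ} {P : E → E}

/-- `P a` is a competitor in the minimization at `b`; expanding the square gives the bound. -/
theorem envelope_le_add (hbot : ∀ x, φ x ≠ ⊥) (hP : ∀ x, IsProx φ c x (P x)) (a b : E) :
    envelope φ c P b ≤
      envelope φ c P a + inner ℝ ((2 * c) • (a - P a)) (b - a) + c * ‖b - a‖ ^ 2 := by
  have h := (hP b).2 (P a) _ (coe_toReal_of_lt_top hbot (hP a).1).ge
  have h1 : b - P a = (b - a) + (a - P a) := by abel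
  rw [h1, norm_add_sq_real, real_inner_comm] at h
  rw [real_inner_smul_left, envelope, envelope]
  linarith

/-- The quadratic upper bound, used in both directions between two points, squeezes the increment;
continuity of `P` makes the error `o(s - t)`. -/
theorem hasDerivAt_envelope_line (hbot : ∀ x, φ x ≠ ⊥) (hP : ∀ x, IsProx φ c x (P x))
    (hPc : Continuous P) (a u : E) (t : ℝ) :
    HasDerivAt (fun t : ℝ => envelope φ c P (a + t • u))
      (inner ℝ ((2 * c) • (a + t • u - P (a + t • u))) u) t := by
  set g : ℝ → ℝ := fun t => inner ℝ ((2 * c) • (a + t • u - P (a + t • u))) u with hg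
  have hgc : Continuous g := by fun_prop
  rw [hasDerivAt_iff_isLittleO, Asymptotics.isLittleO_iff]
  intro ε hε
  have hlim : Tendsto (fun s => |g s - g t| + |c| * ‖u‖ ^ 2 * |s - t|) (𝓝 t) (𝓝 0) := by
    have : Continuous fun s => |g s - g t| + |c| * ‖u‖ ^ 2 * |s - t| := by fun_prop
    simpa using this.tendsto t
  filter_upwards [hlim.eventually (gt_mem_nhds hε)] with s hs
  have h1 := envelope_le_add hbot hP (a + t • u) (a + s • u)
  have h2 := envelope_le_add hbot hP (a + s • u) (a + t • u)
  have e1 : a + s • u - (a + t • u) = (s - t) • u := by module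
  have e2 : a + t • u - (a + s • u) = (t - s) • u := by module
  rw [e1, real_inner_smul_right, norm_smul, mul_pow, Real.norm_eq_abs, sq_abs] at h1
  rw [e2, real_inner_smul_right, norm_smul, mul_pow, Real.norm_eq_abs, sq_abs] at h2
  change _ ≤ _ + (s - t) * g t + _ at h1
  change _ ≤ _ + (t - s) * g s + _ at h2
  rw [smul_eq_mul]
  change ‖_ - _ - (s - t) * g t‖ ≤ _
  set X := envelope φ c P (a + s • u) - envelope φ c P (a + t • u) with hX
  have hq : c * ((s - t) ^ 2 * ‖u‖ ^ 2) ≤ |c| * ‖u‖ ^ 2 * |s - t| * |s - t| := by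
    rw [mul_assoc _ |s - t|, ← pow_two, sq_abs]
    have := mul_le_mul_of_nonneg_right (le_abs_self c)
      (mul_nonneg (sq_nonneg (s - t)) (sq_nonneg ‖u‖))
    linarith
  have hts : (t - s) ^ 2 = (s - t) ^ 2 := by ring
  have hm := mul_le_mul_of_nonneg_right hs.le (abs_nonneg (s - t))
  have hprod : |(g s - g t) * (s - t)| = |g s - g t| * |s - t| := abs_mul _ _
  have hp0 : 0 ≤ |g s - g t| * |s - t| := by positivity
  have hp1 := neg_abs_le ((g s - g t) * (s - t))
  rw [Real.norm_eq_abs, Real.norm_eq_abs, abs_le]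
  rw [hts] at h2
  constructor <;> nlinarith

/-- The slopes of the gradient of the envelope along a line have nonnegative lower limits. -/
theorem frequently_slope_neg_gradient_lt [FiniteDimensional ℝ E] (hbot : ∀ x, φ x ≠ ⊥)
    (hc : 0 ≤ c) (hP : ∀ x, IsProx φ c x (P x)) {L : ℝ}
    (hL : ∀ x y, ‖P x - P y‖ ≤ L * ‖x - y‖) (hpsd : SubgradientGraphicalPSD φ)
    (a u : E) (t r : ℝ) (hr : 0 < r) :
    ∃ᶠ s in 𝓝[>] t,
      slope (fun t : ℝ => -inner ℝ ((2 * c) • (a + t • u - P (a + t • u))) u) t s < r := by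
  have := FiniteDimensional.proper ℝ E
  let τ : ℕ → ℝ := fun k => 1 / ((k : ℝ) + 1)
  have hτ : ∀ k, 0 < τ k := fun k => Nat.one_div_pos_of_nat
  have hτ0 : Tendsto τ atTop (𝓝 0) := tendsto_one_div_add_atTop_nhds_zero_nat
  set x := a + t • u with hx
  let w : ℕ → E := fun k => (τ k)⁻¹ • (P (x + τ k • u) - P x)
  have hw : ∀ k, w k ∈ Metric.closedBall (0 : E) (L * ‖u‖) := by
    intro k
    have h := hL (x + τ k • u) x
    rw [add_sub_cancel_left, norm_smul, Real.norm_eq_abs, abs_of_pos (hτ k)] at h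
    rw [mem_closedBall_zero_iff, norm_smul, norm_inv, Real.norm_eq_abs, abs_of_pos (hτ k),
      inv_mul_le_iff₀ (hτ k)]
    linarith
  obtain ⟨w₀, -, σ, hσ, hlim⟩ := tendsto_subseq_of_bounded Metric.isBounded_closedBall hw
  have hPw : ∀ k, P (x + τ k • u) = P x + τ k • w k := by
    intro k
    simp only [w, smul_smul, mul_inv_cancel₀ (hτ k).ne', one_smul]
    abel
  have hGw : ∀ k, (2 * c) • (x + τ k • u - P (x + τ k • u)) =
      (2 * c) • (x - P x) + τ k • ((2 * c) • (u - w k)) := by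
    intro k; rw [hPw]; module
  have hz : Tendsto (fun k => (2 * c) • (u - w (σ k))) atTop (𝓝 ((2 * c) • (u - w₀))) :=
    (tendsto_const_nhds.sub hlim).const_smul _
  have htan : (2 * c) • (u - w₀) ∈
      graphicalDerivative (limitingSubdifferential φ) (P x) ((2 * c) • (x - P x)) w₀ := by
    refine ⟨(hP x).mem_gph hbot, fun k => τ (σ k), fun k => (w (σ k), (2 * c) • (u - w (σ k))),
      fun k => hτ _, hτ0.comp hσ.tendsto_atTop, hlim.prodMk_nhds hz, fun k => ?_⟩
    have := (hP (x + τ (σ k) • u)).mem_gph hbot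
    rw [hGw, hPw] at this
    exact this
  have h0 := hpsd _ _ ((hP x).mem_gph hbot) _ _ htan
  have h1 : 0 ≤ inner ℝ ((2 * c) • (u - w₀)) u := by
    -- Split `u = w₀ + (u - w₀)`: the first term is the hypothesis on tangent pairs, the second a
    -- square.
    have h2 : inner ℝ ((2 * c) • (u - w₀)) u =
        inner ℝ ((2 * c) • (u - w₀)) w₀ + 2 * c * ‖u - w₀‖ ^ 2 := by
      rw [← real_inner_self_eq_norm_sq, ← real_inner_smul_left, ← inner_add_right]
      congr 1
      abel
    rw [h2]
    positivity
  have h3 : ∀ᶠ k in atTop, -r < inner ℝ ((2 * c) • (u - w (σ k))) u :=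
    (hz.inner tendsto_const_nhds).eventually (lt_mem_nhds (by linarith))
  have hs : Tendsto (fun k => t + τ (σ k)) atTop (𝓝[>] t) := by
    refine tendsto_nhdsWithin_iff.2 ⟨?_, Eventually.of_forall fun k => ?_⟩
    · simpa using (hτ0.comp hσ.tendsto_atTop).const_add t
    · simpa using hτ (σ k)
  refine hs.frequently (Eventually.frequently ?_)
  filter_upwards [h3] with k hk
  have e1 : a + (t + τ (σ k)) • u = x + τ (σ k) • u := by rw [hx]; module
  have hτk := hτ (σ k)
  rw [slope_def_field, e1, hGw, inner_add_left, real_inner_smul_left _ _ (τ (σ k)), ← hx,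
    div_lt_iff₀ (by linarith)]
  nlinarith

theorem convexOn_envelope_line [FiniteDimensional ℝ E] (hbot : ∀ x, φ x ≠ ⊥)
    (hc : 0 ≤ c) (hP : ∀ x, IsProx φ c x (P x)) {L : ℝ}
    (hL : ∀ x y, ‖P x - P y‖ ≤ L * ‖x - y‖) (hpsd : SubgradientGraphicalPSD φ) (a u : E) :
    ConvexOn ℝ Set.univ fun t : ℝ => envelope φ c P (a + t • u) := by
  have hPc : Continuous P :=
    (LipschitzWith.of_dist_le' fun x y => by simpa [dist_eq_norm] using hL x y).continuous
  have hder := hasDerivAt_envelope_line hbot hP hPc a u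
  refine Monotone.convexOn_univ_of_deriv (fun t => (hder t).differentiableAt) ?_
  intro t₁ t₂ h12
  rw [(hder t₁).deriv, (hder t₂).deriv]
  have hcont : Continuous fun t : ℝ => -inner ℝ ((2 * c) • (a + t • u - P (a + t • u))) u := by
    fun_prop
  -- This criterion bounds functions from above, hence the minus sign; it asks for small slopes only
  -- frequently, so one convergent subsequence at each point suffices.
  have := image_le_of_liminf_slope_right_le_deriv_boundary hcont.continuousOn
    (B := fun _ => -inner ℝ ((2 * c) • (a + t₁ • u - P (a + t₁ • u))) u) (B' := fun _ => 0)
    le_rfl continuousOn_const (fun x _ => hasDerivWithinAt_const _ _ _)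
    (fun x _ r hr => frequently_slope_neg_gradient_lt hbot hc hP hL hpsd a u x r hr)
    (Set.right_mem_Icc.2 h12)
  linarith

theorem envelope_combo_le [FiniteDimensional ℝ E] (hbot : ∀ x, φ x ≠ ⊥)
    (hc : 0 ≤ c) (hP : ∀ x, IsProx φ c x (P x)) {L : ℝ}
    (hL : ∀ x y, ‖P x - P y‖ ≤ L * ‖x - y‖) (hpsd : SubgradientGraphicalPSD φ)
    {x y : E} {α β t : ℝ} (hx : φ x ≤ α) (hy : φ y ≤ β) (h0 : 0 < t) (h1 : t < 1) :
    envelope φ c P ((1 - t) • x + t • y) ≤ (1 - t) * α + t * β := by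
  have h := (convexOn_envelope_line hbot hc hP hL hpsd x (y - x)).2 (Set.mem_univ 0)
    (Set.mem_univ 1) (by linarith : 0 ≤ 1 - t) h0.le (by ring)
  have hex : envelope φ c P x ≤ α := by
    simpa [envelope] using (hP x).2 x α hx
  have hey : envelope φ c P y ≤ β := by
    simpa [envelope] using (hP y).2 y β hy
  have e1 : x + ((1 - t) • (0 : ℝ) + t • (1 : ℝ)) • (y - x) = (1 - t) • x + t • y := by
    simp only [smul_eq_mul, mul_zero, mul_one, zero_add]
    module
  simp only [e1] at h
  simp only [zero_smul, add_zero, one_smul, add_sub_cancel, smul_eq_mul] at h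
  nlinarith

/-- Weak convexity together with positive semidefiniteness of the subgradient graphical
derivative implies convexity. -/
theorem IsWeaklyConvex.isConvex [FiniteDimensional ℝ E] (hφ : IsProper φ)
    (hlsc : LowerSemicontinuous φ) (h : IsWeaklyConvex φ) (hpsd : SubgradientGraphicalPSD φ) :
    IsConvex φ := by
  obtain ⟨s, hs, h⟩ := h
  obtain ⟨r, rfl⟩ : ∃ r, s = -r := ⟨-s, by ring⟩
  have hr : 0 ≤ r := by linarith
  have hbot := hφ.1
  refine isSConvex_of_le_coe hbot fun x y α β t hx hy h0 h1 => ?_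
  have hc : ∀ k : ℕ, r / 2 < r + (k + 1) := fun k => by
    have : (0 : ℝ) ≤ k := k.cast_nonneg
    linarith
  choose P hP using fun k : ℕ => h.exists_isProx hr (hc k) hφ hlsc
  set z := (1 - t) • x + t • y with hz
  set M := (1 - t) * α + t * β with hM
  have hle : ∀ k : ℕ, envelope φ (r + (k + 1)) (P k) z ≤ M := fun k =>
    envelope_combo_le hbot (by linarith [hc k]) (hP k)
      (fun x y => (hP k x).norm_sub_le hbot hr (hc k) h (hP k y)) hpsd hx hy h0 h1
  set m := envelope φ (r + ((0 : ℕ) + 1)) (P 0) z with hm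
  -- The parameters exceed the first one, `r + 1`, by exactly `k`: minimality of `P 0 z` absorbs the
  -- `r + 1` part, and the surplus forces `P k z → z`.
  have hbound : ∀ k : ℕ, m + k * ‖z - P k z‖ ^ 2 ≤ M := by
    intro k
    have h2 := (hP 0 z).2 (P k z) _ (coe_toReal_of_lt_top hbot (hP k z).1).ge
    have h3 := hle k
    rw [envelope] at h3 hm
    push_cast at *
    linarith
  have hval : ∀ k, φ (P k z) ≤ (M : EReal) := by
    intro k
    rw [← coe_toReal_of_lt_top hbot (hP k z).1, EReal.coe_le_coe_iff]
    have h3 := hle k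
    rw [envelope] at h3
    have : 0 ≤ (r + (k + 1)) * ‖z - P k z‖ ^ 2 :=
      mul_nonneg (by linarith [hc k]) (sq_nonneg _)
    linarith
  have hsq : Tendsto (fun k => ‖z - P k z‖ ^ 2) atTop (𝓝 0) := by
    refine squeeze_zero' (Eventually.of_forall fun k => sq_nonneg _) ?_
      (tendsto_const_div_atTop_nhds_zero_nat (M - m))
    filter_upwards [eventually_gt_atTop 0] with k hk
    rw [le_div_iff₀ (by exact_mod_cast hk)]
    linarith [hbound k]
  have hlim : Tendsto (fun k => P k z) atTop (𝓝 z) := by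
    rw [tendsto_iff_norm_sub_tendsto_zero]
    have := hsq.sqrt
    simpa [Real.sqrt_sq, norm_sub_rev] using this
  have hzM : φ z ≤ (M : EReal) :=
    (hlsc.isClosed_preimage (M : EReal)).mem_of_tendsto hlim (Eventually.of_forall hval)
  simpa using hzM

end Envelope

/-! ### Convex functions: monotonicity of the subdifferential. -/

section Convex

variable {E : Type*} [NormedAddCommGroup E] [InnerProductSpace ℝ E]

/-- The segment from `ζ` to `z` stays in `C`, and both sides of the defining inequality are
homogeneous along it, so the local bound is global. -/
theorem inner_nonpos_of_mem_regularNormalCone {C : Set E} (hC : Convex ℝ C) {ζ v z : E}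
    (hv : v ∈ regularNormalCone C ζ) (hz : z ∈ C) : inner ℝ v (z - ζ) ≤ 0 := by
  obtain ⟨hζ, h⟩ := hv
  have hlim : Tendsto (fun t : ℝ => ζ + t • (z - ζ)) (𝓝[>] 0) (𝓝[C] ζ) := by
    refine tendsto_nhdsWithin_iff.2 ⟨?_, ?_⟩
    · have : Continuous fun t : ℝ => ζ + t • (z - ζ) := by fun_prop
      simpa using (this.tendsto 0).mono_left nhdsWithin_le_nhds
    · filter_upwards [Ioo_mem_nhdsGT (zero_lt_one (α := ℝ))] with t ht
      exact hC.add_smul_sub_mem hζ hz ⟨ht.1.le, ht.2.le⟩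
  have key : ∀ ε : ℝ, 0 < ε → inner ℝ v (z - ζ) ≤ ε * ‖z - ζ‖ := by
    intro ε hε
    obtain ⟨t, ht, h0⟩ := ((hlim.eventually (h ε hε)).and self_mem_nhdsWithin).exists
    have h0 : 0 < t := h0
    rw [add_sub_cancel_left, real_inner_smul_right, norm_smul, Real.norm_eq_abs,
      abs_of_pos h0] at ht
    refine le_of_mul_le_mul_left ?_ h0
    linarith
  have hl : Tendsto (fun ε : ℝ => ε * ‖z - ζ‖) (𝓝[>] 0) (𝓝 0) := by
    have : Continuous fun ε : ℝ => ε * ‖z - ζ‖ := by fun_prop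
    simpa using (this.tendsto 0).mono_left nhdsWithin_le_nhds
  exact ge_of_tendsto hl (by filter_upwards [self_mem_nhdsWithin] with ε hε using key ε hε)

theorem inner_nonpos_of_mem_limitingNormalCone {C : Set E} (hC : Convex ℝ C) {ζ v z : E}
    (hv : v ∈ limitingNormalCone C ζ) (hz : z ∈ C) : inner ℝ v (z - ζ) ≤ 0 := by
  obtain ⟨-, ζ', ν, -, h1, h2, h3⟩ := hv
  exact le_of_tendsto' (h2.inner (tendsto_const_nhds.sub h1))
    fun k => inner_nonpos_of_mem_regularNormalCone hC (h3 k) hz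

theorem IsConvex.convex_epigraph {φ : E → EReal} (h : IsConvex φ) :
    Convex ℝ (epigraph φ) := by
  refine convex_iff_forall_pos.2 fun p hp q hq a b ha hb hab => ?_
  obtain rfl : a = 1 - b := by linarith
  have := IsSConvex.le_coe h hp hq hb (by linarith)
  simpa [epigraph] using this

theorem IsConvex.subgradient_inequality {φ : E → EReal} (hbot : ∀ x, φ x ≠ ⊥) (h : IsConvex φ)
    {x v y : E} (hv : v ∈ limitingSubdifferential φ x) (hy : φ y < ⊤) :
    (φ x).toReal + inner ℝ v (y - x) ≤ (φ y).toReal := by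
  have hm : WithLp.toLp 2 (y, (φ y).toReal) ∈ epigraph φ := (coe_toReal_of_lt_top hbot hy).ge
  have := inner_nonpos_of_mem_limitingNormalCone h.convex_epigraph hv.2 hm
  rw [← WithLp.toLp_sub, Prod.mk_sub_mk, inner_toLp_prod] at this
  linarith

/-- Adding the two subgradient inequalities between `(x, y)` and a nearby graph point gives `t² ⟪u₂,
u₁⟫ ≥ 0`; divide by `t²` and pass to the limit. -/
theorem IsConvex.subgradientGraphicalPSD {φ : E → EReal} (hbot : ∀ x, φ x ≠ ⊥)
    (h : IsConvex φ) : SubgradientGraphicalPSD φ := by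
  intro x y hxy w z hz
  obtain ⟨-, t, u, ht, -, hu, hmem⟩ := hz
  have hlim : Tendsto (fun k => inner ℝ (u k).2 (u k).1) atTop (𝓝 (inner ℝ z w)) :=
    ((continuous_snd.tendsto _).comp hu).inner ((continuous_fst.tendsto _).comp hu)
  refine ge_of_tendsto' hlim fun k => ?_
  have h1 : y ∈ limitingSubdifferential φ x := hxy
  have h2 : y + t k • (u k).2 ∈ limitingSubdifferential φ (x + t k • (u k).1) := hmem k
  have i1 := h.subgradient_inequality hbot h1 h2.1
  have i2 := h.subgradient_inequality hbot h2 h1.1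
  rw [add_sub_cancel_left] at i1
  rw [sub_add_cancel_left] at i2
  simp only [inner_add_left, inner_neg_right, real_inner_smul_left, real_inner_smul_right]
    at i1 i2
  have h3 : 0 ≤ t k * t k * inner ℝ (u k).2 (u k).1 := by linarith
  exact nonneg_of_mul_nonneg_right h3 (mul_pos (ht k) (ht k))

theorem IsConvex.isWeaklyConvex {φ : E → EReal} (hbot : ∀ x, φ x ≠ ⊥) (h : IsConvex φ) :
    IsWeaklyConvex φ := by
  refine ⟨-1, by norm_num, isSConvex_of_le_coe hbot fun x y α β t hx hy h0 h1 => ?_⟩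
  refine (IsSConvex.le_coe h hx hy h0 h1).trans ?_
  rw [EReal.coe_le_coe_iff]
  have : 0 ≤ t * (1 - t) * ‖x - y‖ ^ 2 :=
    mul_nonneg (mul_nonneg h0.le (by linarith)) (sq_nonneg _)
  linarith

end Convex

/-! ### The counterexample without weak convexity. -/

section OffOrigin

variable {E : Type*} [NormedAddCommGroup E]

theorem offOrigin_zero : offOrigin (0 : E) = 0 := by simp [offOrigin]

theorem offOrigin_of_ne {x : E} (hx : x ≠ 0) : offOrigin x = 1 := by simp [offOrigin, hx]

theorem lowerSemicontinuous_offOrigin : LowerSemicontinuous (offOrigin : E → EReal) := by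
  intro x a ha
  rcases eq_or_ne x 0 with rfl | hx
  · rw [offOrigin_zero] at ha
    refine Eventually.of_forall fun y => ha.trans_le ?_
    rcases eq_or_ne y 0 with rfl | hy
    · rw [offOrigin_zero]
    · rw [offOrigin_of_ne hy]; exact zero_le_one
  · filter_upwards [isOpen_ne.mem_nhds hx] with y hy
    rwa [offOrigin_of_ne hy, ← offOrigin_of_ne hx]

theorem isProper_offOrigin [InnerProductSpace ℝ E] : IsProper (offOrigin : E → EReal) := by
  refine ⟨fun x => ?_, 0, by rw [offOrigin_zero]; exact EReal.zero_lt_top⟩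
  rcases eq_or_ne x 0 with rfl | hx
  · rw [offOrigin_zero]; exact EReal.zero_ne_bot
  · rw [offOrigin_of_ne hx]; exact EReal.coe_ne_bot 1

variable [InnerProductSpace ℝ E]

/-- Away from the origin the regular normals to the epigraph of `offOrigin` are vertical. -/
theorem fst_eq_zero_of_mem_regularNormalCone_offOrigin {ζ ν : WithLp 2 (E × ℝ)}
    (hζ : ζ.fst ≠ 0) (hν : ν ∈ regularNormalCone (epigraph offOrigin) ζ) : ν.fst = 0 := by
  obtain ⟨hmem, h⟩ := hν
  by_contra hne
  have hpos : 0 < ‖ν.fst‖ := norm_pos_iff.2 hne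
  -- Horizontal moves never leave the epigraph at height at least `1`, so moving along the
  -- horizontal part of `ν` contradicts normality.
  set e : WithLp 2 (E × ℝ) := WithLp.toLp 2 (ν.fst, (0 : ℝ)) with he
  have hle : (1 : EReal) ≤ (ζ.snd : EReal) := by
    have : offOrigin ζ.fst ≤ (ζ.snd : EReal) := hmem
    rwa [offOrigin_of_ne hζ] at this
  have hlim : Tendsto (fun t : ℝ => ζ + t • e) (𝓝[>] 0) (𝓝[epigraph offOrigin] ζ) := by
    refine tendsto_nhdsWithin_iff.2 ⟨?_, Eventually.of_forall fun t => ?_⟩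
    · have : Continuous fun t : ℝ => ζ + t • e := by fun_prop
      simpa using (this.tendsto 0).mono_left nhdsWithin_le_nhds
    · have hs : (ζ + t • e).snd = ζ.snd := by simp [he]
      change offOrigin (ζ + t • e).fst ≤ ((ζ + t • e).snd : EReal)
      rw [hs]
      refine le_trans ?_ hle
      rcases eq_or_ne (ζ + t • e).fst 0 with h0 | h0
      · rw [h0, offOrigin_zero]; exact zero_le_one
      · rw [offOrigin_of_ne h0]
  obtain ⟨t, ht, h0⟩ := ((hlim.eventually (h (‖ν.fst‖ / 2) (by positivity))).and
    self_mem_nhdsWithin).exists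
  have h0 : 0 < t := h0
  have hin : inner ℝ ν e = ‖ν.fst‖ ^ 2 := by
    rw [← real_inner_self_eq_norm_sq]
    simp [he, WithLp.prod_inner_apply]
  have hno : ‖e‖ = ‖ν.fst‖ := by
    have := WithLp.prod_norm_sq_eq_of_L2 e
    rw [← sq_eq_sq₀ (norm_nonneg _) (norm_nonneg _), this]
    simp [he]
  rw [add_sub_cancel_left, real_inner_smul_right, norm_smul, Real.norm_eq_abs,
    abs_of_pos h0, hin, hno] at ht
  have : 0 < t * ‖ν.fst‖ ^ 2 := by positivity
  linarith

theorem eq_zero_or_eq_zero_of_mem_limitingSubdifferential_offOrigin {x v : E}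
    (hv : v ∈ limitingSubdifferential offOrigin x) : x = 0 ∨ v = 0 := by
  refine or_iff_not_imp_left.2 fun hx => ?_
  obtain ⟨-, -, ζ, ν, -, h1, h2, h3⟩ := hv
  have hfst : Continuous fun p : WithLp 2 (E × ℝ) => p.fst := by fun_prop
  have h4 : Tendsto (fun k => (ζ k).fst) atTop (𝓝 x) := (hfst.tendsto _).comp h1
  have h5 : Tendsto (fun k => (ν k).fst) atTop (𝓝 v) := (hfst.tendsto _).comp h2
  refine tendsto_nhds_unique h5 (tendsto_const_nhds.congr' ?_)
  filter_upwards [h4.eventually (isOpen_ne.mem_nhds hx)] with k hk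
  exact (fst_eq_zero_of_mem_regularNormalCone_offOrigin hk (h3 k)).symm

/-- Near a graph point other than `(0, 0)` only one axis is visible, and at `(0, 0)` each difference
quotient lies on an axis; in both cases the inner products vanish before the limit. -/
theorem subgradientGraphicalPSD_offOrigin :
    SubgradientGraphicalPSD (offOrigin : E → EReal) := by
  intro x y hxy w z hz
  obtain ⟨-, t, u, ht, ht0, hu, hmem⟩ := hz
  have hw : Tendsto (fun k => (u k).1) atTop (𝓝 w) := (continuous_fst.tendsto _).comp hu
  have hz : Tendsto (fun k => (u k).2) atTop (𝓝 z) := (continuous_snd.tendsto _).comp hu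
  have hx' : Tendsto (fun k => x + t k • (u k).1) atTop (𝓝 x) := by
    simpa using (ht0.smul hw).const_add x
  have hy' : Tendsto (fun k => y + t k • (u k).2) atTop (𝓝 y) := by
    simpa using (ht0.smul hz).const_add y
  have hk : ∀ k, x + t k • (u k).1 = 0 ∨ y + t k • (u k).2 = 0 := fun k =>
    eq_zero_or_eq_zero_of_mem_limitingSubdifferential_offOrigin (hmem k)
  have hcross : x = 0 ∨ y = 0 :=
    eq_zero_or_eq_zero_of_mem_limitingSubdifferential_offOrigin hxy
  have hzero : ∀ᶠ k in atTop, inner ℝ (u k).2 (u k).1 = 0 := by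
    rcases eq_or_ne x 0 with hx | hx
    · rcases eq_or_ne y 0 with hy | hy
      · refine Eventually.of_forall fun k => ?_
        rcases hk k with h | h
        · rw [hx, zero_add, smul_eq_zero_iff_right (ht k).ne'] at h
          rw [h, inner_zero_right]
        · rw [hy, zero_add, smul_eq_zero_iff_right (ht k).ne'] at h
          rw [h, inner_zero_left]
      · filter_upwards [hy'.eventually (isOpen_ne.mem_nhds hy)] with k hne
        have h := (hk k).resolve_right hne
        rw [hx, zero_add, smul_eq_zero_iff_right (ht k).ne'] at h
        rw [h, inner_zero_right]
    · filter_upwards [hx'.eventually (isOpen_ne.mem_nhds hx)] with k hne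
      have h := (hk k).resolve_left hne
      rw [hcross.resolve_left hx, zero_add, smul_eq_zero_iff_right (ht k).ne'] at h
      rw [h, inner_zero_left]
  exact (tendsto_nhds_unique (hz.inner hw)
    (tendsto_const_nhds.congr' (hzero.mono fun k h => h.symm))).ge

/-- On a segment leaving the origin the value jumps to `1`, while the bound tends to `0` as `t → 0`,
whatever the sign of `s`. -/
theorem not_isSConvex_offOrigin [Nontrivial E] (s : ℝ) :
    ¬ IsSConvex s (offOrigin : E → EReal) := by
  intro h
  obtain ⟨e, he⟩ := exists_ne (0 : E)
  have key : ∀ t : ℝ, 0 < t → t < 1 → 1 ≤ t - s / 2 * t * (1 - t) * ‖e‖ ^ 2 := by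
    intro t h0 h1
    have h2 := h.le_coe (x := 0) (y := e) (α := 0) (β := 1) (by rw [offOrigin_zero]; rfl)
      (by rw [offOrigin_of_ne he]; rfl) h0 h1
    rw [smul_zero, zero_add, offOrigin_of_ne (smul_ne_zero h0.ne' he), ← EReal.coe_one,
      EReal.coe_le_coe_iff] at h2
    simpa using h2
  have hl : Tendsto (fun t : ℝ => t - s / 2 * t * (1 - t) * ‖e‖ ^ 2) (𝓝[>] 0) (𝓝 0) := by
    have : Continuous fun t : ℝ => t - s / 2 * t * (1 - t) * ‖e‖ ^ 2 := by fun_prop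
    simpa using (this.tendsto 0).mono_left nhdsWithin_le_nhds
  have : (1 : ℝ) ≤ 0 := by
    refine ge_of_tendsto hl ?_
    filter_upwards [Ioo_mem_nhdsGT (zero_lt_one (α := ℝ))] with t ht
    exact key t ht.1 ht.2
  linarith

end OffOrigin

end VarAnalysis

theorem mainTheorem1 :
    (∀ (n : ℕ) (φ : EuclideanSpace ℝ (Fin n) → EReal),
      VarAnalysis.IsProper φ → LowerSemicontinuous φ →
        (VarAnalysis.IsConvex φ ↔
          VarAnalysis.IsWeaklyConvex φ ∧ VarAnalysis.SubgradientGraphicalPSD φ)) ∧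
    (∃ φ : EuclideanSpace ℝ (Fin 1) → EReal, φ = VarAnalysis.offOrigin ∧
      VarAnalysis.IsProper φ ∧ LowerSemicontinuous φ ∧
      VarAnalysis.SubgradientGraphicalPSD φ ∧
      ¬ VarAnalysis.IsWeaklyConvex φ ∧ ¬ VarAnalysis.IsConvex φ) := by
  refine ⟨fun n φ hφ hlsc => ⟨fun h => ⟨h.isWeaklyConvex hφ.1, h.subgradientGraphicalPSD hφ.1⟩,
    fun h => h.1.isConvex hφ hlsc h.2⟩, VarAnalysis.offOrigin, rfl,
    VarAnalysis.isProper_offOrigin, VarAnalysis.lowerSemicontinuous_offOrigin,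
    VarAnalysis.subgradientGraphicalPSD_offOrigin, ?_, VarAnalysis.not_isSConvex_offOrigin 0⟩
  rintro ⟨s, -, h⟩
  exact VarAnalysis.not_isSConvex_offOrigin s h
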